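/- Let $c,n\ge 1$ be integers, let $\mathcal X$ be a measurable space (for instance a Borel subset of $\mathbb R^d$), and let $D$ be a probability distribution on $\mathcal X\times\{-1,+1\}^c$. For $y\in\{-1,+1\}^c$ put $Y^+=\{j:y_j=1\}$ and $Y^-=\{j:y_j=-1\}$. **Losses.** For a predicted label vector $z\in\{-1,+1\}^c$ and a score vector $s\in\mathbb R^c$ put $$L_h^{0/1}(z,y)=\frac1c\sum_{j=1}^c[\![z_j\ne y_j]\!],\qquad L_s^{0/1}(z,y)=\max_{1\le j\le c}[\![z_j\ne y_j]\!],$$ $$L_r^{0/1}(s,y)=\frac1{|Y^+||Y^-|}\sum_{p\in Y^+}\sum_{q\in Y^-}[\![s_p\le s_q]\!],\qquad L_r(s,y)=\frac1{|Y^+||Y^-|}\sum_{p\in Y^+}\sum_{q\in Y^-}\ell(s_p-s_q),$$ where both ranking losses are $0$ if $Y^+$ or $Y^-$ is empty. **Hypothesis set.** Let $\kappa:\mathcal X\times\mathcal X\to\mathbb R$ be a (jointly measurable) positive definite symmetric kernel with a feature map $\phi:\mathcal X\to\mathbb H$ into a real Hilbert space, i.e. $\kappa(x,x')=\langle\phi(x),\phi(x')\rangle$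 (for instance the RKHS of $\kappa$ and its canonical map), and let $r>0$ satisfy $\kappa(x,x)\le r^2$ for all $x\in\mathcal X$. For $\Lambda\in\mathbb R$ let $$\mathcal F=\Big\{x\mapsto(\langle w_1,\phi(x)\rangle,\dots,\langle w_c,\phi(x)\rangle):\ w_1,\dots,w_c\in\mathbb H,\ \Big(\sum_{j=1}^c\|w_j\|^2\Big)^{1/2}\le\Lambda\Big\}.$$ **Base loss.** Let $\ell:\mathbb R\to\mathbb R$ be $\rho$-Lipschitz, let it dominate the $0/1$ loss, i.e. $[\![u\le0]\!]\le\ell(u)$ for all $u\in\mathbb R$, and let it be bounded by $B$ on the score differences that occur: $\ell(f_p(x)-f_q(x))\le B$ for all $f\in\mathcal F$, $x\in\mathcal X$ and $p,q\in\{1,\dots,c\}$. **Oracle thresholding.** Thresholding $s$ at $T\in\mathbb R$ gives the label vector whose $j$-th entry is $+1$ if $s_j\ge T$ and $-1$ otherwise. Let $t^*$ be an oracle optimal thresholding function: for each score vector $s$ and true label vector $y$, it returns a thresholding of $s$ whose Hamming loss $L_h^{0/1}(\cdot,y)$ is the smallest among all thresholdings of $s$. Write $t^*\circ f(x)$ for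 the prediction it returns for $s=f(x)$ and the true label vector $y$ of $x$. **Risks.** Put $R^s_{0/1}(t^*\circ f)=\mathbb E_{(x,y)\sim D}[L_s^{0/1}(t^*\circ f(x),y)]$, $R^r_{0/1}(f)=\mathbb E_{(x,y)\sim D}[L_r^{0/1}(f(x),y)]$ and, for a sample $S=((x_i,y_i))_{i=1}^n$, $\hat R^r_S(f)=\frac1n\sum_{i=1}^nL_r(f(x_i),y_i)$. **Theorem.** For every $\delta>0$, with probability at least $1-\delta$ over the draw of an i.i.d. sample $S\sim D^n$, the following holds for all $f\in\mathcal F$ simultaneously: $$R^s_{0/1}(t^*\circ f)\ \le\ c^2R^r_{0/1}(f)\ \le\ c^2\hat R^r_S(f)+2\sqrt2\,\rho\sqrt{\frac{c^5\Lambda^2r^2}{n}}+3Bc^2\sqrt{\frac{\log(2/\delta)}{2n}}.$$ (For $\delta\ge 1$ the assertion is void.) -/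

import Mathlib

open MeasureTheory

noncomputable section

/-- Label vectors `y ∈ {-1, +1}^c`; `y j = 1` means that label `j` is relevant. -/
abbrev Labels (c : ℕ) : Type := Fin c → ℤˣ

/-- The index set `Y⁺` of the relevant labels. -/
def relevant {c : ℕ} (y : Labels c) : Finset (Fin c) := Finset.univ.filter fun j => y j = 1

/-- The index set `Y⁻` of the irrelevant labels. -/
def irrelevant {c : ℕ} (y : Labels c) : Finset (Fin c) := Finset.univ.filter fun j => y j = -1

/-- The `0/1` Hamming loss of a predicted label vector `z`. -/
def hammingLoss01 {c : ℕ} (z y : Labels c) : ℝ :=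
  (1 / (c : ℝ)) * ∑ j, if z j ≠ y j then (1 : ℝ) else 0

/-- The `0/1` subset loss of a predicted label vector `z`
(a maximum over the finite index set of labels). -/
def subsetLoss01 {c : ℕ} (z y : Labels c) : ℝ :=
  ⨆ j, if z j ≠ y j then (1 : ℝ) else 0

/-- The `0/1` ranking loss of a score vector `s`; it is `0` when `Y⁺` or `Y⁻` is empty. -/
def rankingLoss01 {c : ℕ} (s : Fin c → ℝ) (y : Labels c) : ℝ :=
  (1 / (((relevant y).card : ℝ) * ((irrelevant y).card : ℝ))) *
    ∑ p ∈ relevant y, ∑ q ∈ irrelevant y, if s p ≤ s q then (1 : ℝ) else 0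

/-- The surrogate ranking loss with base loss `ℓ`; it is `0` when `Y⁺` or `Y⁻` is empty. -/
def rankingLoss {c : ℕ} (ℓ : ℝ → ℝ) (s : Fin c → ℝ) (y : Labels c) : ℝ :=
  (1 / (((relevant y).card : ℝ) * ((irrelevant y).card : ℝ))) *
    ∑ p ∈ relevant y, ∑ q ∈ irrelevant y, ℓ (s p - s q)

/-- The label vector obtained from the scores `s` with the threshold `T`. -/
def thresholdLabels {c : ℕ} (T : ℝ) (s : Fin c → ℝ) : Labels c :=
  fun j => if T ≤ s j then 1 else -1

/-- `t` is an oracle optimal thresholding function: for every score vector `s` and every true label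
vector `y`, the prediction `t s y` is obtained by thresholding `s`, and its Hamming loss is the
smallest among all thresholdings of `s`. -/
structure IsOracleThresholding {c : ℕ} (t : (Fin c → ℝ) → Labels c → Labels c) : Prop where
  isThresholding : ∀ s y, ∃ T : ℝ, t s y = thresholdLabels T s
  isOptimal : ∀ s y, ∀ T : ℝ, hammingLoss01 (t s y) y ≤ hammingLoss01 (thresholdLabels T s) y

/-- Oracle optimal thresholding functions exist. -/
theorem exists_isOracleThresholding (c : ℕ) :
    ∃ t : (Fin c → ℝ) → Labels c → Labels c, IsOracleThresholding t := by
  have key : ∀ (s : Fin c → ℝ) (y : Labels c), ∃ z : Labels c,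
      (∃ T : ℝ, z = thresholdLabels T s) ∧
        ∀ T : ℝ, hammingLoss01 z y ≤ hammingLoss01 (thresholdLabels T s) y := by
    intro s y
    obtain ⟨z, ⟨T, hT⟩, hz⟩ := Set.exists_min_image
      (Set.range fun T : ℝ => thresholdLabels T s) (fun z => hammingLoss01 z y)
      (Set.toFinite _) ⟨_, 0, rfl⟩
    exact ⟨z, ⟨T, hT.symm⟩, fun T' => hz _ ⟨T', rfl⟩⟩
  choose t h1 h2 using key
  exact ⟨t, h1, h2⟩

/-- `φ : X → H` is a feature map of the kernel `κ` (so `κ` is a positive definite symmetric kernel).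
The reproducing kernel Hilbert space of `κ` with its canonical map is one such choice. -/
def IsFeatureMap {X H : Type*} [NormedAddCommGroup H] [InnerProductSpace ℝ H]
    (κ : X → X → ℝ) (φ : X → H) : Prop :=
  ∀ x x', κ x x' = inner ℝ (φ x) (φ x')

/-- The kernel-based hypothesis set: the maps `x ↦ (⟪w₁, φ x⟫, …, ⟪w_c, φ x⟫)` with
`(∑ j, ‖w_j‖²)^(1/2) ≤ Λ`. -/
def kernelClass {X H : Type*} [NormedAddCommGroup H] [InnerProductSpace ℝ H]
    (c : ℕ) (φ : X → H) (Λ : ℝ) : Set (X → Fin c → ℝ) :=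
  {f | ∃ W : Fin c → H, Real.sqrt (∑ j, ‖W j‖ ^ 2) ≤ Λ ∧ f = fun x j => inner ℝ (W j) (φ x)}

/-- The base loss bounds the `0/1` loss from above. -/
def BoundsZeroOne (ℓ : ℝ → ℝ) : Prop :=
  ∀ u : ℝ, (if u ≤ 0 then (1 : ℝ) else 0) ≤ ℓ u

/-- The expected `0/1` subset risk of the classifier `t ∘ f`. -/
def subsetRisk01 {X : Type*} [MeasurableSpace X] {c : ℕ} (D : Measure (X × Labels c))
    (t : (Fin c → ℝ) → Labels c → Labels c) (f : X → Fin c → ℝ) : ℝ :=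
  ∫ z, subsetLoss01 (t (f z.1) z.2) z.2 ∂D

/-- The expected `0/1` ranking risk of the score function `f`. -/
def rankingRisk01 {X : Type*} [MeasurableSpace X] {c : ℕ} (D : Measure (X × Labels c))
    (f : X → Fin c → ℝ) : ℝ :=
  ∫ z, rankingLoss01 (f z.1) z.2 ∂D

/-- The empirical surrogate ranking risk of `f` on the sample `S`. -/
def empRankingRisk {X : Type*} {c n : ℕ} (ℓ : ℝ → ℝ) (S : Fin n → X × Labels c)
    (f : X → Fin c → ℝ) : ℝ :=
  (1 / (n : ℝ)) * ∑ i, rankingLoss ℓ (f (S i).1) (S i).2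

end

/-- The real number `±1` encoded by a Boolean. -/
def signReal (b : Bool) : ℝ := if b then 1 else -1

/-- The average of a function over the sign cube. -/
noncomputable def signAvg {n : ℕ} (F : (Fin n → Bool) → ℝ) : ℝ := (∑ ε, F ε) / 2 ^ n

theorem signAvg_zero (F : (Fin 0 → Bool) → ℝ) : signAvg F = F Fin.elim0 := by
  simp only [signAvg, Fintype.sum_unique, pow_zero, div_one]
  congr 1

theorem signAvg_succ {n : ℕ} (F : (Fin (n + 1) → Bool) → ℝ) :
    signAvg F = (signAvg (fun ε => F (Fin.cons true ε)) +
      signAvg (fun ε => F (Fin.cons false ε))) / 2 := by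
  have h := (Fin.consEquiv (fun _ : Fin (n + 1) => Bool)).sum_comp F
  rw [Fintype.sum_prod_type, Fintype.sum_bool] at h
  simp only [signAvg, ← h, pow_succ]
  field_simp
  rfl

theorem signAvg_mono {n : ℕ} {F G : (Fin n → Bool) → ℝ} (h : ∀ ε, F ε ≤ G ε) :
    signAvg F ≤ signAvg G := by
  unfold signAvg
  gcongr with ε
  exact h ε

theorem signAvg_add {n : ℕ} (F G : (Fin n → Bool) → ℝ) :
    signAvg (fun ε => F ε + G ε) = signAvg F + signAvg G := by
  simp only [signAvg, Finset.sum_add_distrib, add_div]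

theorem signAvg_const_mul {n : ℕ} (a : ℝ) (F : (Fin n → Bool) → ℝ) :
    signAvg (fun ε => a * F ε) = a * signAvg F := by
  simp only [signAvg, ← Finset.mul_sum, mul_div_assoc]

theorem signAvg_sum {n : ℕ} {K : Type*} (s : Finset K) (F : K → (Fin n → Bool) → ℝ) :
    signAvg (fun ε => ∑ k ∈ s, F k ε) = ∑ k ∈ s, signAvg (F k) := by
  simp only [signAvg, ← Finset.sum_div]
  rw [Finset.sum_comm]

theorem signAvg_const {n : ℕ} (a : ℝ) : signAvg (fun _ : Fin n → Bool => a) = a := by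
  simp [signAvg]

theorem half_exp_add_exp_le (a b : ℝ) :
    (Real.exp a + Real.exp b) / 2 ≤ Real.exp ((a + b) / 2 + (a - b) ^ 2 / 8) := by
  have h := Real.cosh_le_exp_half_sq ((a - b) / 2)
  have h2 : (Real.exp a + Real.exp b) / 2 = Real.exp ((a + b) / 2) * Real.cosh ((a - b) / 2) := by
    rw [Real.cosh_eq, mul_div_assoc', mul_add, ← Real.exp_add, ← Real.exp_add]
    ring_nf
  rw [h2, Real.exp_add]
  gcongr
  refine h.trans (le_of_eq ?_)
  ring_nf

/-- McDiarmid's exponential moment bound on the sign cube. -/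
theorem signAvg_exp_le {n : ℕ} (F : (Fin n → Bool) → ℝ) (d : ℝ)
    (hF : ∀ ε i, |F (Function.update ε i true) - F (Function.update ε i false)| ≤ d) :
    signAvg (fun ε => Real.exp (F ε)) ≤ Real.exp (signAvg F + n * d ^ 2 / 8) := by
  induction n with
  | zero => simp [signAvg_zero]
  | succ n ih =>
    have hb : ∀ b : Bool, signAvg (fun ε => Real.exp (F (Fin.cons b ε))) ≤
        Real.exp (signAvg (fun ε => F (Fin.cons b ε)) + n * d ^ 2 / 8) := by
      intro b
      refine ih (fun ε => F (Fin.cons b ε)) fun ε i => ?_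
      have h := hF (Fin.cons b ε) i.succ
      rwa [← Fin.cons_update, ← Fin.cons_update] at h
    set p := signAvg (fun ε => F (Fin.cons true ε))
    set q := signAvg (fun ε => F (Fin.cons false ε))
    have h1 : ∀ ε : Fin n → Bool, |F (Fin.cons true ε) - F (Fin.cons false ε)| ≤ d := by
      intro ε
      simpa using hF (Fin.cons true ε) 0
    have hpq : |p - q| ≤ d := by
      rw [abs_le]
      constructor
      · have := signAvg_mono (n := n) (F := fun ε => F (Fin.cons false ε))
          (G := fun ε => F (Fin.cons true ε) + d) fun ε => by
            linarith [(abs_le.1 (h1 ε)).1]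
        rw [signAvg_add, signAvg_const] at this
        linarith
      · have := signAvg_mono (n := n) (F := fun ε => F (Fin.cons true ε))
          (G := fun ε => F (Fin.cons false ε) + d) fun ε => by
            linarith [(abs_le.1 (h1 ε)).2]
        rw [signAvg_add, signAvg_const] at this
        linarith
    rw [signAvg_succ, signAvg_succ]
    refine (div_le_div_of_nonneg_right (add_le_add (hb true) (hb false)) (by norm_num)).trans ?_
    refine (half_exp_add_exp_le _ _).trans (Real.exp_le_exp.2 ?_)
    have h2 : (p - q) ^ 2 ≤ d ^ 2 := sq_le_sq' (by linarith [(abs_le.1 hpq).1]) (abs_le.1 hpq).2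
    push_cast
    have h3 : (p + n * d ^ 2 / 8 - (q + n * d ^ 2 / 8)) ^ 2 = (p - q) ^ 2 := by ring
    rw [h3]
    linarith

theorem bddAbove_range_of_abs_le {ι : Sort*} {f : ι → ℝ} {C : ℝ} (h : ∀ w, |f w| ≤ C) :
    BddAbove (Set.range f) :=
  ⟨C, by rintro _ ⟨w, rfl⟩; exact (abs_le.1 (h w)).2⟩

/-- The one-coordinate step of the contraction principle, for a function which is Lipschitz with
respect to a convex combination of semi-distances. -/
theorem ciSup_add_add_ciSup_sub_le {ι K : Type*} [Nonempty ι] [Fintype K] (g a : ι → ℝ)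
    (b : K → ι → ℝ) (m : K → ℝ) (hm0 : ∀ k, 0 ≤ m k) (hm1 : ∑ k, m k = 1)
    (hab : ∀ w w', |a w - a w'| ≤ ∑ k, m k * |b k w - b k w'|)
    (hg : ∃ C, ∀ w, |g w| ≤ C) (hb : ∀ k, ∃ C, ∀ w, |b k w| ≤ C) :
    (⨆ w, g w + a w) + (⨆ w, g w - a w) ≤
      ∑ k, m k * ((⨆ w, g w + b k w) + ⨆ w, g w - b k w) := by
  obtain ⟨C, hC⟩ := hg
  choose C' hC' using hb
  have key : ∀ w w', (g w + a w) + (g w' - a w') ≤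
      ∑ k, m k * ((⨆ w, g w + b k w) + ⨆ w, g w - b k w) := by
    intro w w'
    have h1 : ∀ k, g w + g w' + |b k w - b k w'| ≤
        (⨆ w, g w + b k w) + ⨆ w, g w - b k w := by
      intro k
      have hp : ∀ w, g w + b k w ≤ ⨆ w, g w + b k w := le_ciSup (bddAbove_range_of_abs_le
        (C := C + C' k) fun w => (abs_add_le _ _).trans (add_le_add (hC w) (hC' k w)))
      have hq : ∀ w, g w - b k w ≤ ⨆ w, g w - b k w := le_ciSup (bddAbove_range_of_abs_le
        (C := C + C' k) fun w => (abs_sub _ _).trans (add_le_add (hC w) (hC' k w)))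
      rcases abs_cases (b k w - b k w') with ⟨h, -⟩ | ⟨h, -⟩ <;> rw [h]
      · linarith [hp w, hq w']
      · linarith [hp w', hq w]
    calc (g w + a w) + (g w' - a w') ≤ g w + g w' + |a w - a w'| := by
          linarith [le_abs_self (a w - a w')]
      _ ≤ g w + g w' + ∑ k, m k * |b k w - b k w'| := by linarith [hab w w']
      _ = ∑ k, m k * (g w + g w' + |b k w - b k w'|) := by
          simp only [mul_add _ (g w + g w'), Finset.sum_add_distrib, ← Finset.sum_mul, hm1, one_mul]
      _ ≤ _ := Finset.sum_le_sum fun k _ => mul_le_mul_of_nonneg_left (h1 k) (hm0 k)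
  have h2 : ∀ w', (⨆ w, g w + a w) ≤
      (∑ k, m k * ((⨆ w, g w + b k w) + ⨆ w, g w - b k w)) - (g w' - a w') :=
    fun w' => ciSup_le fun w => by linarith [key w w']
  have h3 : (⨆ w, g w - a w) ≤
      (∑ k, m k * ((⨆ w, g w + b k w) + ⨆ w, g w - b k w)) - ⨆ w, g w + a w :=
    ciSup_le fun w' => by linarith [h2 w']
  linarith

theorem sum_mul_half_sqrt_le {E K : Type*} [NormedAddCommGroup E] [InnerProductSpace ℝ E]
    [Fintype K] (m : K → ℝ) (hm0 : ∀ k, 0 ≤ m k) (hm1 : ∑ k, m k = 1) (v : E) (ψ : K → E)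
    (β : ℝ) (hβ : 0 ≤ β) :
    ∑ k, m k * ((√(‖v + ψ k‖ ^ 2 + β) + √(‖v - ψ k‖ ^ 2 + β)) / 2) ≤
      √(‖v‖ ^ 2 + (∑ k, m k * ‖ψ k‖ ^ 2 + β)) := by
  have h1 : ∀ k, (√(‖v + ψ k‖ ^ 2 + β) + √(‖v - ψ k‖ ^ 2 + β)) / 2 ≤
      √(‖v‖ ^ 2 + ‖ψ k‖ ^ 2 + β) := by
    intro k
    have hp := parallelogram_law_with_norm ℝ v (ψ k)
    refine Real.le_sqrt_of_sq_le ?_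
    have h4 := Real.sq_sqrt (show 0 ≤ ‖v + ψ k‖ ^ 2 + β by positivity)
    have h5 := Real.sq_sqrt (show 0 ≤ ‖v - ψ k‖ ^ 2 + β by positivity)
    nlinarith [sq_nonneg (√(‖v + ψ k‖ ^ 2 + β) - √(‖v - ψ k‖ ^ 2 + β))]
  have h2 := Real.strictConcaveOn_sqrt.concaveOn.le_map_sum (t := Finset.univ) (w := m)
    (p := fun k => ‖v‖ ^ 2 + ‖ψ k‖ ^ 2 + β) (fun k _ => hm0 k) hm1
    (fun k _ => by simp only [Set.mem_Ici]; positivity)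
  simp only [smul_eq_mul] at h2
  refine (Finset.sum_le_sum fun k _ => mul_le_mul_of_nonneg_left (h1 k) (hm0 k)).trans
    (h2.trans (le_of_eq ?_))
  congr 1
  simp only [mul_add, Finset.sum_add_distrib, ← Finset.sum_mul, hm1, one_mul]
  ring

/-- Rademacher averages over a Hilbert ball of functions which are Lipschitz with respect to
convex combinations of linear functionals: contraction and the norm bound in one induction. -/
theorem signAvg_ciSup_closedBall_le {E K : Type*} [NormedAddCommGroup E] [InnerProductSpace ℝ E]
    [Fintype K] (Λ : ℝ) (hΛ : 0 ≤ Λ) {n : ℕ} (a : Fin n → E → ℝ) (m : Fin n → K → ℝ)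
    (ψ : Fin n → K → E) (hm0 : ∀ i k, 0 ≤ m i k) (hm1 : ∀ i, ∑ k, m i k = 1)
    (ha : ∀ i w w', |a i w - a i w'| ≤ ∑ k, m i k * |inner ℝ w (ψ i k) - inner ℝ w' (ψ i k)|)
    (hbd : ∀ i, ∃ C, ∀ w : Metric.closedBall (0 : E) Λ, |a i w| ≤ C) (v : E) :
    signAvg (fun ε : Fin n → Bool => ⨆ w : Metric.closedBall (0 : E) Λ,
        (inner ℝ (w : E) v + ∑ i, signReal (ε i) * a i w)) ≤
      Λ * √(‖v‖ ^ 2 + ∑ i, ∑ k, m i k * ‖ψ i k‖ ^ 2) := by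
  have : Nonempty (Metric.closedBall (0 : E) Λ) := ⟨⟨0, Metric.mem_closedBall_self hΛ⟩⟩
  have hin : ∀ (w : Metric.closedBall (0 : E) Λ) (u : E), |inner ℝ (w : E) u| ≤ Λ * ‖u‖ :=
    fun w u => (abs_real_inner_le_norm _ _).trans
      (mul_le_mul_of_nonneg_right (mem_closedBall_zero_iff.1 w.2) (norm_nonneg _))
  induction n generalizing v with
  | zero =>
    simp only [signAvg_zero, Finset.univ_eq_empty, Finset.sum_empty, add_zero,
      Real.sqrt_sq (norm_nonneg v)]
    exact ciSup_le fun w => (abs_le.1 (hin w v)).2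
  | succ n ih =>
    have ih' := ih (fun i => a i.succ) (fun i => m i.succ) (fun i => ψ i.succ)
      (fun i => hm0 i.succ) (fun i => hm1 i.succ) (fun i => ha i.succ) (fun i => hbd i.succ)
    set β := ∑ i : Fin n, ∑ k, m i.succ k * ‖ψ i.succ k‖ ^ 2
    have hβ : 0 ≤ β := Finset.sum_nonneg fun i _ => Finset.sum_nonneg fun k _ =>
      mul_nonneg (hm0 _ _) (sq_nonneg _)
    let G : (Fin n → Bool) → E → Metric.closedBall (0 : E) Λ → ℝ := fun ε u w =>
      inner ℝ (w : E) u + ∑ i, signReal (ε i) * a i.succ w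
    have hG : ∀ ε u, ∃ C, ∀ w, |G ε u w| ≤ C := by
      intro ε u
      choose C hC using hbd
      refine ⟨Λ * ‖u‖ + ∑ i : Fin n, C i.succ, fun w => (abs_add_le _ _).trans
        (add_le_add (hin w u) ((Finset.abs_sum_le_sum_abs _ _).trans
          (Finset.sum_le_sum fun i _ => ?_)))⟩
      have hs : |signReal (ε i)| = 1 := by cases ε i <;> simp [signReal]
      rw [abs_mul, hs, one_mul]
      exact hC i.succ w
    have step : ∀ ε : Fin n → Bool,
        (⨆ w, G ε v w + a 0 w) + (⨆ w, G ε v w - a 0 w) ≤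
          ∑ k, m 0 k * ((⨆ w, G ε (v + ψ 0 k) w) + ⨆ w, G ε (v - ψ 0 k) w) := by
      intro ε
      have h := ciSup_add_add_ciSup_sub_le (G ε v) (fun w => a 0 w)
        (fun k (w : Metric.closedBall (0 : E) Λ) => inner ℝ (w : E) (ψ 0 k)) (m 0) (hm0 0) (hm1 0)
        (fun w w' => ha 0 w w') (hG ε v) (fun k => ⟨_, fun w => hin w _⟩)
      refine h.trans (le_of_eq ?_)
      refine Finset.sum_congr rfl fun k _ => ?_
      congr 2 <;> refine iSup_congr fun w => ?_
      · simp only [G, inner_add_right]; ring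
      · simp only [G, inner_sub_right]; ring
    rw [signAvg_succ]
    have e1 : ∀ ε : Fin n → Bool, (⨆ w : Metric.closedBall (0 : E) Λ, (inner ℝ (w : E) v +
        ∑ i, signReal ((Fin.cons true ε : Fin (n + 1) → Bool) i) * a i w)) =
        ⨆ w, G ε v w + a 0 w := by
      intro ε
      refine iSup_congr fun w => ?_
      simp only [G, Fin.sum_univ_succ, Fin.cons_zero, Fin.cons_succ, signReal, if_true]
      ring
    have e2 : ∀ ε : Fin n → Bool, (⨆ w : Metric.closedBall (0 : E) Λ, (inner ℝ (w : E) v +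
        ∑ i, signReal ((Fin.cons false ε : Fin (n + 1) → Bool) i) * a i w)) =
        ⨆ w, G ε v w - a 0 w := by
      intro ε
      refine iSup_congr fun w => ?_
      simp only [G, Fin.sum_univ_succ, Fin.cons_zero, Fin.cons_succ, signReal]
      simp
      ring
    simp only [e1, e2]
    rw [← signAvg_add]
    calc _ ≤ signAvg (fun ε => ∑ k, m 0 k *
            ((⨆ w, G ε (v + ψ 0 k) w) + ⨆ w, G ε (v - ψ 0 k) w)) / 2 :=
          div_le_div_of_nonneg_right (signAvg_mono step) (by norm_num)
      _ = ∑ k, m 0 k * ((signAvg (fun ε => ⨆ w, G ε (v + ψ 0 k) w) +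
            signAvg (fun ε => ⨆ w, G ε (v - ψ 0 k) w)) / 2) := by
          rw [signAvg_sum, Finset.sum_div]
          refine Finset.sum_congr rfl fun k _ => ?_
          rw [signAvg_const_mul, signAvg_add, mul_div_assoc]
      _ ≤ ∑ k, m 0 k * ((Λ * √(‖v + ψ 0 k‖ ^ 2 + β) + Λ * √(‖v - ψ 0 k‖ ^ 2 + β)) / 2) := by
          refine Finset.sum_le_sum fun k _ => mul_le_mul_of_nonneg_left ?_ (hm0 0 k)
          exact div_le_div_of_nonneg_right (add_le_add (ih' _) (ih' _)) (by norm_num)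
      _ = Λ * ∑ k, m 0 k * ((√(‖v + ψ 0 k‖ ^ 2 + β) + √(‖v - ψ 0 k‖ ^ 2 + β)) / 2) := by
          rw [Finset.mul_sum]
          exact Finset.sum_congr rfl fun k _ => by ring
      _ ≤ _ := by
          rw [Fin.sum_univ_succ]
          exact mul_le_mul_of_nonneg_left
            (sum_mul_half_sqrt_le (m 0) (hm0 0) (hm1 0) v (ψ 0) β hβ) hΛ

/-- Exchange the `i`-th entries of two samples whenever `ε i` is false. -/
def swapSample {Y : Type*} {n : ℕ} (ε : Fin n → Bool) (p : (Fin n → Y) × (Fin n → Y)) :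
    (Fin n → Y) × (Fin n → Y) :=
  (fun i => if ε i then p.1 i else p.2 i, fun i => if ε i then p.2 i else p.1 i)

theorem measurePreserving_swapSample {Y : Type*} [MeasurableSpace Y] (D : Measure Y)
    [IsProbabilityMeasure D] {n : ℕ} (ε : Fin n → Bool) :
    MeasurePreserving (swapSample ε)
      ((Measure.pi fun _ : Fin n => D).prod (Measure.pi fun _ : Fin n => D))
      ((Measure.pi fun _ : Fin n => D).prod (Measure.pi fun _ : Fin n => D)) := by
  have h1 := measurePreserving_arrowProdEquivProdArrow Y Y (Fin n) (fun _ => D) (fun _ => D)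
  have h2 : MeasurePreserving
      (fun (z : Fin n → Y × Y) i => (if ε i then id else Prod.swap : Y × Y → Y × Y) (z i))
      (Measure.pi fun _ => D.prod D) (Measure.pi fun _ => D.prod D) := by
    refine measurePreserving_pi _ _ fun i => ?_
    cases ε i
    · exact Measure.measurePreserving_swap
    · exact MeasurePreserving.id _
  have h3 := (h1.comp h2).comp h1.symm
  convert h3 using 1
  funext p
  simp only [swapSample, Function.comp_apply]
  ext i
  · cases h : ε i <;>
      simp [h, MeasurableEquiv.arrowProdEquivProdArrow, Equiv.arrowProdEquivProdArrow]
  · cases h : ε i <;>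
      simp [h, MeasurableEquiv.arrowProdEquivProdArrow, Equiv.arrowProdEquivProdArrow]

theorem integral_le_of_signAvg_swapSample_le {Y : Type*} [MeasurableSpace Y] (D : Measure Y)
    [IsProbabilityMeasure D] {n : ℕ} (G : (Fin n → Y) × (Fin n → Y) → ℝ) (C : ℝ)
    (hG : Integrable G ((Measure.pi fun _ : Fin n => D).prod (Measure.pi fun _ : Fin n => D)))
    (hC : ∀ p, signAvg (fun ε => G (swapSample ε p)) ≤ C) :
    ∫ p, G p ∂((Measure.pi fun _ : Fin n => D).prod (Measure.pi fun _ : Fin n => D)) ≤ C := by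
  set P := (Measure.pi fun _ : Fin n => D).prod (Measure.pi fun _ : Fin n => D)
  have hi : ∀ ε, Integrable (fun p => G (swapSample ε p)) P := fun ε =>
    (measurePreserving_swapSample D ε).integrable_comp_of_integrable hG
  have he : ∀ ε, ∫ p, G (swapSample ε p) ∂P = ∫ p, G p ∂P := by
    intro ε
    have hp := measurePreserving_swapSample D ε
    have := integral_map (μ := P) (f := G) hp.measurable.aemeasurable
      (by rw [hp.map_eq]; exact hG.aestronglyMeasurable)
    rw [← this, hp.map_eq]
  have h1 : ∫ p, signAvg (fun ε => G (swapSample ε p)) ∂P = ∫ p, G p ∂P := by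
    simp only [signAvg]
    rw [integral_div, integral_finsetSum _ fun ε _ => hi ε]
    simp [he]
  rw [← h1]
  calc _ ≤ ∫ _, C ∂P := integral_mono
        ((integrable_finsetSum _ fun ε _ => hi ε).div_const _) (integrable_const C) hC
    _ = C := by simp

/-- Uniform deviation bound for a bounded class of functions, in terms of a bound for its
symmetrized Rademacher averages. -/
theorem exists_measurableSet_uniform_deviation {Y ι : Type*} [MeasurableSpace Y] [Nonempty ι]
    (D : Measure Y) [IsProbabilityMeasure D] {n : ℕ} (hn : 0 < n) (h : ι → Y → ℝ)
    (hm : ∀ w, Measurable (h w)) (B R : ℝ) (hB : 0 < B) (h0 : ∀ w y, 0 ≤ h w y)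
    (h1 : ∀ w y, h w y ≤ B)
    (hsup : Measurable fun p : (Fin n → Y) × (Fin n → Y) =>
      ⨆ w, ∑ i, (h w (p.2 i) - h w (p.1 i)))
    (hR : ∀ p : (Fin n → Y) × (Fin n → Y),
      signAvg (fun ε => ⨆ w, ∑ i, signReal (ε i) * (h w (p.2 i) - h w (p.1 i))) ≤ R)
    (δ : ℝ) (hδ : 0 < δ) (hδ1 : δ ≤ 1) :
    ∃ A : Set (Fin n → Y), MeasurableSet A ∧
      ENNReal.ofReal (1 - δ) ≤ (Measure.pi fun _ : Fin n => D) A ∧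
      ∀ S ∈ A, ∀ w, n * ∫ y, h w y ∂D ≤
        ∑ i, h w (S i) + R + 3 * B * n * √(Real.log (2 / δ) / (2 * n)) := by
  set μ := Measure.pi fun _ : Fin n => D with hμ
  set q := √(Real.log (2 / δ) / (2 * n)) with hq
  have hn' : (0 : ℝ) < n := by exact_mod_cast hn
  have hlog : 0 < Real.log (2 / δ) := Real.log_pos (by rw [lt_div_iff₀ hδ]; linarith)
  have hq0 : 0 < q := Real.sqrt_pos.2 (by positivity)
  have hq2 : 2 * n * q ^ 2 = Real.log (2 / δ) := by
    rw [hq, Real.sq_sqrt (by positivity)]; field_simp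
  have hdiff : ∀ w y y', |h w y - h w y'| ≤ B := fun w y y' => by
    rw [abs_le]; constructor <;> linarith [h0 w y, h0 w y', h1 w y, h1 w y']
  have hterm : ∀ (ε : Fin n → Bool) (p : (Fin n → Y) × (Fin n → Y)) (w : ι),
      |∑ i, signReal (ε i) * (h w (p.2 i) - h w (p.1 i))| ≤ n * B := by
    intro ε p w
    refine (Finset.abs_sum_le_sum_abs _ _).trans ?_
    have : ∀ i ∈ Finset.univ, |signReal (ε i) * (h w (p.2 i) - h w (p.1 i))| ≤ B := by
      intro i _
      have hs : |signReal (ε i)| = 1 := by cases ε i <;> simp [signReal]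
      rw [abs_mul, hs, one_mul]
      exact hdiff _ _ _
    simpa using Finset.sum_le_sum this
  have hterm' : ∀ (p : (Fin n → Y) × (Fin n → Y)) (w : ι),
      |∑ i, (h w (p.2 i) - h w (p.1 i))| ≤ n * B := by
    intro p w
    simpa [signReal] using hterm (fun _ => true) p w
  set Φ : (Fin n → Y) × (Fin n → Y) → ℝ := fun p => ⨆ w, ∑ i, (h w (p.2 i) - h w (p.1 i)) with hΦ
  have hΦle : ∀ p w, ∑ i, (h w (p.2 i) - h w (p.1 i)) ≤ Φ p := fun p w =>
    le_ciSup (bddAbove_range_of_abs_le (hterm' p)) w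
  have hΦb : ∀ p, |Φ p| ≤ n * B := by
    intro p
    rw [abs_le]
    refine ⟨?_, ciSup_le fun w => (abs_le.1 (hterm' p w)).2⟩
    obtain ⟨w⟩ := ‹Nonempty ι›
    exact (abs_le.1 (hterm' p w)).1.trans (hΦle p w)
  -- exponential moments of the symmetrized supremum
  set l := 2 * q / B with hl
  have hl0 : 0 < l := by positivity
  have hswap : ∀ ε p, Φ (swapSample ε p) =
      ⨆ w, ∑ i, signReal (ε i) * (h w (p.2 i) - h w (p.1 i)) := by
    intro ε p
    refine iSup_congr fun w => Finset.sum_congr rfl fun i _ => ?_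
    cases hε : ε i <;> simp [swapSample, signReal, hε]
  have hexp : ∀ p, signAvg (fun ε => Real.exp (l * Φ (swapSample ε p))) ≤
      Real.exp (l * R + n * (l * (2 * B)) ^ 2 / 8) := by
    intro p
    refine (signAvg_exp_le (fun ε => l * Φ (swapSample ε p)) (l * (2 * B)) ?_).trans ?_
    · intro ε i
      rw [← mul_sub, abs_mul, abs_of_pos hl0]
      refine mul_le_mul_of_nonneg_left ?_ hl0.le
      simp only [hswap]
      have key : ∀ a b : Bool, (⨆ w, ∑ j, signReal (Function.update ε i a j) *
            (h w (p.2 j) - h w (p.1 j))) ≤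
          (⨆ w, ∑ j, signReal (Function.update ε i b j) * (h w (p.2 j) - h w (p.1 j))) + 2 * B := by
        intro a b
        refine ciSup_le fun w => ?_
        have hle := le_ciSup (bddAbove_range_of_abs_le (hterm (Function.update ε i b) p)) w
        have hd : ∑ j, signReal (Function.update ε i a j) * (h w (p.2 j) - h w (p.1 j)) -
            ∑ j, signReal (Function.update ε i b j) * (h w (p.2 j) - h w (p.1 j)) =
            (signReal a - signReal b) * (h w (p.2 i) - h w (p.1 i)) := by
          rw [← Finset.sum_sub_distrib, Finset.sum_eq_single i]
          · simp; ring
          · intro j _ hj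
            simp [Function.update_of_ne hj]
          · simp
        have hab : (signReal a - signReal b) * (h w (p.2 i) - h w (p.1 i)) ≤ 2 * B := by
          have := abs_le.1 (hdiff w (p.2 i) (p.1 i))
          cases a <;> cases b <;> simp [signReal] <;> linarith
        linarith
      rw [abs_le]
      constructor <;> linarith [key true false, key false true]
    · rw [signAvg_const_mul]
      simp only [hswap]
      gcongr
      exact hR p
  have hint : ∀ (ν : Measure ((Fin n → Y) × (Fin n → Y))) [IsProbabilityMeasure ν],
      Integrable (fun p => Real.exp (l * Φ p)) ν := by
    intro ν _
    refine Integrable.of_bound (C := Real.exp (l * (n * B)))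
      (by fun_prop) (Filter.Eventually.of_forall fun p => ?_)
    rw [Real.norm_eq_abs, abs_of_pos (Real.exp_pos _)]
    gcongr
    exact (abs_le.1 (hΦb p)).2
  have hE := integral_le_of_signAvg_swapSample_le D (fun p => Real.exp (l * Φ p)) _
    (hint _) hexp
  -- the measurable majorant
  set Ψ : (Fin n → Y) → ℝ := fun S => ∫ S', Φ (S, S') ∂μ with hΨ
  have hΨm : Measurable Ψ :=
    (hsup.stronglyMeasurable.integral_prod_right (ν := μ)).measurable
  have hsec : ∀ S, Measurable fun S' => Φ (S, S') := fun S => hsup.comp measurable_prodMk_left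
  have hseci : ∀ S, Integrable (fun S' => Φ (S, S')) μ := fun S =>
    Integrable.of_bound (C := n * B) (hsec S).aestronglyMeasurable
      (Filter.Eventually.of_forall fun S' => hΦb (S, S'))
  have hseci' : ∀ S, Integrable (fun S' => Real.exp (l * Φ (S, S'))) μ := by
    intro S
    refine Integrable.of_bound (C := Real.exp (l * (n * B)))
      ((((hsec S).const_mul l).exp).aestronglyMeasurable)
      (Filter.Eventually.of_forall fun S' => ?_)
    rw [Real.norm_eq_abs, abs_of_pos (Real.exp_pos _)]
    gcongr
    exact (abs_le.1 (hΦb _)).2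
  have hhi : ∀ w, Integrable (h w) D := fun w =>
    Integrable.of_bound (C := B) (hm w).aestronglyMeasurable
      (Filter.Eventually.of_forall fun y => by
        rw [Real.norm_eq_abs, abs_of_nonneg (h0 w y)]; exact h1 w y)
  have hmaj : ∀ S w, n * ∫ y, h w y ∂D - ∑ i, h w (S i) ≤ Ψ S := by
    intro S w
    have hi : ∀ i : Fin n, Integrable (fun S' : Fin n → Y => h w (S' i)) μ := fun i =>
      integrable_comp_eval (hhi w)
    have hi' : ∀ i : Fin n, Integrable (fun S' : Fin n → Y => h w (S' i) - h w (S i)) μ :=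
      fun i => (hi i).sub (integrable_const _)
    have he : ∫ S', ∑ i, (h w (S' i) - h w (S i)) ∂μ = n * ∫ y, h w y ∂D - ∑ i, h w (S i) := by
      rw [integral_finsetSum _ fun i _ => hi' i]
      have : ∀ i : Fin n, ∫ S', (h w (S' i) - h w (S i)) ∂μ = ∫ y, h w y ∂D - h w (S i) := by
        intro i
        rw [integral_sub (hi i) (integrable_const _),
          integral_comp_eval (μ := fun _ : Fin n => D) (hm w).aestronglyMeasurable]
        simp
      simp [this]
    rw [← he]
    exact integral_mono (integrable_finsetSum _ fun i _ => hi' i)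
      (hseci S) fun S' => hΦle (S, S') w
  have hjen : ∀ S, Real.exp (l * Ψ S) ≤ ∫ S', Real.exp (l * Φ (S, S')) ∂μ := by
    intro S
    have := convexOn_exp.map_integral_le (μ := μ) (f := fun S' => l * Φ (S, S'))
      Real.continuous_exp.continuousOn isClosed_univ (Filter.Eventually.of_forall fun _ => trivial)
      ((hseci S).const_mul l) (hseci' S)
    rwa [integral_const_mul] at this
  have hmgf : ∫ S, Real.exp (l * Ψ S) ∂μ ≤ Real.exp (l * R + n * (l * (2 * B)) ^ 2 / 8) := by
    refine le_trans ?_ hE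
    rw [integral_prod _ (hint _)]
    refine integral_mono_of_nonneg (Filter.Eventually.of_forall fun S => (Real.exp_pos _).le)
      (hint _).integral_prod_left (Filter.Eventually.of_forall hjen)
  have hΨi : Integrable (fun S => Real.exp (l * Ψ S)) μ :=
    Integrable.mono' (hint (μ.prod μ)).integral_prod_left
      ((hΨm.const_mul l).exp).aestronglyMeasurable
      (Filter.Eventually.of_forall fun S => by
        rw [Real.norm_eq_abs, abs_of_pos (Real.exp_pos _)]; exact hjen S)
  set t := R + 3 * B * n * q with ht
  have hmark : μ.real {S | t ≤ Ψ S} ≤ δ := by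
    refine (ProbabilityTheory.measure_ge_le_exp_mul_mgf t hl0.le hΨi).trans ?_
    have : Real.exp (-l * t) * ProbabilityTheory.mgf Ψ μ l ≤
        Real.exp (-l * t) * Real.exp (l * R + n * (l * (2 * B)) ^ 2 / 8) :=
      mul_le_mul_of_nonneg_left hmgf (Real.exp_pos _).le
    refine this.trans ?_
    rw [← Real.exp_add]
    have he : -l * t + (l * R + n * (l * (2 * B)) ^ 2 / 8) = -(2 * Real.log (2 / δ)) := by
      rw [← hq2, ht, hl]; field_simp; ring
    rw [he]
    calc Real.exp (-(2 * Real.log (2 / δ))) ≤ Real.exp (-(Real.log (2 / δ))) := by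
          gcongr; linarith
      _ = δ / 2 := by rw [Real.exp_neg, Real.exp_log (by positivity), inv_div]
      _ ≤ δ := by linarith
  have hset : MeasurableSet {S | t ≤ Ψ S} := measurableSet_le measurable_const hΨm
  refine ⟨{S | t ≤ Ψ S}ᶜ, hset.compl, ?_, ?_⟩
  · rw [← ofReal_measureReal, probReal_compl_eq_one_sub hset]
    exact ENNReal.ofReal_le_ofReal (by linarith)
  · intro S hS w
    have hS' : Ψ S < t := not_le.1 hS
    linarith [hmaj S w]

theorem measurableSingletonClass_labels (c : ℕ) : MeasurableSingletonClass (Labels c) := by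
  have : MeasurableSingletonClass ℤˣ := by
    refine ⟨fun u => ⟨{(u : ℤ)}, MeasurableSet.singleton _, ?_⟩⟩
    ext v
    simp [Units.ext_iff]
  exact Pi.instMeasurableSingletonClass

/-- The weight of a pair of labels in the ranking losses. -/
noncomputable def pairWeight {c : ℕ} (y : Labels c) (x : Fin c × Fin c) : ℝ :=
  if x.1 ∈ relevant y ∧ x.2 ∈ irrelevant y then
    1 / (((relevant y).card : ℝ) * ((irrelevant y).card : ℝ)) else 0

theorem pairWeight_nonneg {c : ℕ} (y : Labels c) (x : Fin c × Fin c) : 0 ≤ pairWeight y x := by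
  unfold pairWeight
  split_ifs <;> positivity

theorem rankingLoss_eq_sum_pairWeight {c : ℕ} (ℓ : ℝ → ℝ) (s : Fin c → ℝ) (y : Labels c) :
    rankingLoss ℓ s y = ∑ x : Fin c × Fin c, pairWeight y x * ℓ (s x.1 - s x.2) := by
  rw [rankingLoss, Finset.mul_sum, Fintype.sum_prod_type, ← Finset.sum_filter_add_sum_filter_not
    Finset.univ (fun p => p ∈ relevant y) (fun p => ∑ q, pairWeight y (p, q) * ℓ (s p - s q))]
  have h0 : ∑ p with p ∉ relevant y, ∑ q, pairWeight y (p, q) * ℓ (s p - s q) = 0 := by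
    refine Finset.sum_eq_zero fun p hp => Finset.sum_eq_zero fun q _ => ?_
    simp [pairWeight, (Finset.mem_filter.1 hp).2]
  rw [h0, add_zero, Finset.filter_mem_eq_inter, Finset.univ_inter]
  refine Finset.sum_congr rfl fun p hp => ?_
  rw [Finset.mul_sum, ← Finset.sum_filter_add_sum_filter_not Finset.univ
    (fun q => q ∈ irrelevant y)]
  have h1 : ∑ q with q ∉ irrelevant y, pairWeight y (p, q) * ℓ (s p - s q) = 0 := by
    refine Finset.sum_eq_zero fun q hq => ?_
    simp [pairWeight, (Finset.mem_filter.1 hq).2]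
  rw [h1, add_zero, Finset.filter_mem_eq_inter, Finset.univ_inter]
  refine Finset.sum_congr rfl fun q hq => ?_
  simp [pairWeight, hp, hq]

theorem sum_pairWeight {c : ℕ} (y : Labels c) :
    ∑ x, pairWeight y x = 1 ∨ ∀ x, pairWeight y x = 0 := by
  by_cases h : ((relevant y).card : ℝ) * ((irrelevant y).card : ℝ) = 0
  · right
    intro x
    simp [pairWeight, h]
  · left
    have := rankingLoss_eq_sum_pairWeight (fun _ => 1) 0 y
    simp only [mul_one] at this
    rw [← this, rankingLoss]
    simp only [Finset.sum_const, nsmul_eq_mul, mul_one]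
    exact one_div_mul_cancel h

theorem rankingLoss_nonneg {c : ℕ} {ℓ : ℝ → ℝ} (h : ∀ u, 0 ≤ ℓ u) (s : Fin c → ℝ)
    (y : Labels c) : 0 ≤ rankingLoss ℓ s y := by
  rw [rankingLoss_eq_sum_pairWeight]
  exact Finset.sum_nonneg fun x _ => mul_nonneg (pairWeight_nonneg y x) (h _)

theorem rankingLoss_le {c : ℕ} {ℓ : ℝ → ℝ} {s : Fin c → ℝ} {B : ℝ} (hB : 0 ≤ B)
    (h : ∀ p q, ℓ (s p - s q) ≤ B) (y : Labels c) : rankingLoss ℓ s y ≤ B := by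
  rw [rankingLoss_eq_sum_pairWeight]
  refine (Finset.sum_le_sum fun x _ =>
    mul_le_mul_of_nonneg_left (h x.1 x.2) (pairWeight_nonneg y x)).trans ?_
  rw [← Finset.sum_mul]
  rcases sum_pairWeight y with h | h
  · rw [h, one_mul]
  · simpa [h] using hB

theorem rankingLoss01_eq_rankingLoss {c : ℕ} (s : Fin c → ℝ) (y : Labels c) :
    rankingLoss01 s y = rankingLoss (fun u => if u ≤ 0 then 1 else 0) s y := by
  simp only [rankingLoss01, rankingLoss, sub_nonpos]

theorem rankingLoss01_le_rankingLoss {c : ℕ} {ℓ : ℝ → ℝ} (h : BoundsZeroOne ℓ)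
    (s : Fin c → ℝ) (y : Labels c) : rankingLoss01 s y ≤ rankingLoss ℓ s y := by
  rw [rankingLoss01_eq_rankingLoss, rankingLoss_eq_sum_pairWeight, rankingLoss_eq_sum_pairWeight]
  exact Finset.sum_le_sum fun x _ => mul_le_mul_of_nonneg_left (h _) (pairWeight_nonneg y x)

theorem measurable_rankingLoss {c : ℕ} {ℓ : ℝ → ℝ} (hℓ : Measurable ℓ) :
    Measurable fun p : (Fin c → ℝ) × Labels c => rankingLoss ℓ p.1 p.2 := by
  have := measurableSingletonClass_labels c
  refine measurable_from_prod_countable_left fun y => ?_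
  simp only [rankingLoss]
  fun_prop

theorem Measurable.rankingLoss {Ω : Type*} [MeasurableSpace Ω] {c : ℕ} {ℓ : ℝ → ℝ}
    (hℓ : Measurable ℓ) {s : Ω → Fin c → ℝ} (hs : ∀ j, Measurable fun ω => s ω j)
    {y : Ω → Labels c} (hy : Measurable y) :
    Measurable fun ω => _root_.rankingLoss ℓ (s ω) (y ω) := by
  have h := Measurable.comp (measurable_rankingLoss hℓ (c := c))
    ((measurable_pi_lambda s hs).prodMk hy)
  exact h

/-- The ranking loss is Lipschitz with respect to an average of the pairwise score differences. -/
theorem exists_weights_abs_rankingLoss_sub_le {c : ℕ} (hc : 0 < c) {ℓ : ℝ → ℝ} {ρ : NNReal}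
    (hℓ : LipschitzWith ρ ℓ) (y : Labels c) :
    ∃ m : Fin c × Fin c → ℝ, (∀ x, 0 ≤ m x) ∧ ∑ x, m x = 1 ∧ ∀ s s' : Fin c → ℝ,
      |rankingLoss ℓ s y - rankingLoss ℓ s' y| ≤
        ∑ x, m x * (ρ * |(s x.1 - s x.2) - (s' x.1 - s' x.2)|) := by
  rcases sum_pairWeight y with h | h
  · refine ⟨pairWeight y, pairWeight_nonneg y, h, fun s s' => ?_⟩
    rw [rankingLoss_eq_sum_pairWeight, rankingLoss_eq_sum_pairWeight, ← Finset.sum_sub_distrib]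
    refine (Finset.abs_sum_le_sum_abs _ _).trans (Finset.sum_le_sum fun x _ => ?_)
    rw [← mul_sub, abs_mul, abs_of_nonneg (pairWeight_nonneg y x)]
    refine mul_le_mul_of_nonneg_left ?_ (pairWeight_nonneg y x)
    simpa only [Real.dist_eq] using hℓ.dist_le_mul (s x.1 - s x.2) (s' x.1 - s' x.2)
  · refine ⟨Pi.single (⟨0, hc⟩, ⟨0, hc⟩) 1, fun x => ?_, by simp, fun s s' => ?_⟩
    · exact (Pi.single_nonneg.2 zero_le_one : (0 : Fin c × Fin c → ℝ) ≤ _) x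
    · rw [rankingLoss_eq_sum_pairWeight, rankingLoss_eq_sum_pairWeight]
      simp only [h, zero_mul, Finset.sum_const_zero, sub_self, abs_zero]
      refine Finset.sum_nonneg fun x _ => mul_nonneg ?_ (by positivity)
      exact (Pi.single_nonneg.2 zero_le_one : (0 : Fin c × Fin c → ℝ) ≤ _) x

/-- An oracle thresholding errs only if some relevant label is not ranked above some irrelevant
one. -/
theorem subsetLoss01_le_sq_mul_rankingLoss01 {c : ℕ} (hc : 0 < c)
    {t : (Fin c → ℝ) → Labels c → Labels c} (ht : IsOracleThresholding t) (s : Fin c → ℝ)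
    (y : Labels c) : subsetLoss01 (t s y) y ≤ (c : ℝ) ^ 2 * rankingLoss01 s y := by
  have : Nonempty (Fin c) := ⟨⟨0, hc⟩⟩
  have hc' : (0 : ℝ) < c := by exact_mod_cast hc
  by_cases hsep : ∀ p ∈ relevant y, ∀ q ∈ irrelevant y, s q < s p
  · have hT : ∃ T : ℝ, thresholdLabels T s = y := by
      obtain ⟨T, hT1, hT2⟩ : ∃ T : ℝ, (∀ p ∈ relevant y, T ≤ s p) ∧
          ∀ q ∈ irrelevant y, s q < T := by
        rcases (relevant y).eq_empty_or_nonempty with h | h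
        · refine ⟨∑ j, |s j| + 1, by simp [h], fun q _ => ?_⟩
          have := Finset.single_le_sum (f := fun j => |s j|) (fun j _ => abs_nonneg _)
            (Finset.mem_univ q)
          linarith [le_abs_self (s q)]
        · obtain ⟨p, hp, hmin⟩ := Finset.exists_min_image (relevant y) s h
          exact ⟨s p, hmin, hsep p hp⟩
      refine ⟨T, funext fun j => ?_⟩
      rcases Int.units_eq_one_or (y j) with h | h
      · simp [thresholdLabels, h, hT1 j (by simp [relevant, h])]
      · simp [thresholdLabels, h, not_le.2 (hT2 j (by simp [irrelevant, h]))]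
    obtain ⟨T, hT⟩ := hT
    have h0 := ht.isOptimal s y T
    rw [hT] at h0
    have hy : hammingLoss01 y y = 0 := by simp [hammingLoss01]
    rw [hy, hammingLoss01] at h0
    have hsum : ∑ j, (if t s y j ≠ y j then (1 : ℝ) else 0) ≤ 0 := by
      by_contra! h
      exact absurd h0 (not_le.2 (mul_pos (by positivity) h))
    have hz : ∀ j, t s y j = y j := by
      intro j
      by_contra hj
      have := Finset.single_le_sum (f := fun j => if t s y j ≠ y j then (1 : ℝ) else 0)
        (fun j _ => by split_ifs <;> norm_num) (Finset.mem_univ j)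
      simp only [ne_eq, hj, not_false_eq_true, if_true] at this hsum
      linarith
    have : subsetLoss01 (t s y) y = 0 := by simp [subsetLoss01, hz]
    rw [this, rankingLoss01_eq_rankingLoss]
    exact mul_nonneg (by positivity)
      (rankingLoss_nonneg (fun u => by split_ifs <;> norm_num) s y)
  · push Not at hsep
    obtain ⟨p, hp, q, hq, hpq⟩ := hsep
    have h1 : subsetLoss01 (t s y) y ≤ 1 := ciSup_le fun j => by split_ifs <;> norm_num
    refine h1.trans ?_
    have hP : 0 < (relevant y).card := Finset.card_pos.2 ⟨p, hp⟩
    have hQ : 0 < (irrelevant y).card := Finset.card_pos.2 ⟨q, hq⟩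
    have hPc : (relevant y).card ≤ c := by simpa using Finset.card_le_univ (relevant y)
    have hQc : (irrelevant y).card ≤ c := by simpa using Finset.card_le_univ (irrelevant y)
    have hone : (1 : ℝ) ≤ ∑ p ∈ relevant y, ∑ q ∈ irrelevant y, if s p ≤ s q then (1 : ℝ) else 0 := by
      have hn : ∀ p q, (0 : ℝ) ≤ if s p ≤ s q then (1 : ℝ) else 0 := fun p q => by
        split_ifs <;> norm_num
      have a1 := Finset.single_le_sum (f := fun p => ∑ q ∈ irrelevant y,
        if s p ≤ s q then (1 : ℝ) else 0) (fun p _ => Finset.sum_nonneg fun q _ => hn p q) hp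
      have a2 := Finset.single_le_sum (f := fun q => if s p ≤ s q then (1 : ℝ) else 0)
        (fun q _ => hn p q) hq
      simp only [hpq, if_true] at a2
      exact a2.trans a1
    have hcard : ((relevant y).card : ℝ) * (irrelevant y).card ≤ (c : ℝ) ^ 2 := by
      rw [sq]
      exact_mod_cast Nat.mul_le_mul hPc hQc
    have hpos : (0 : ℝ) < ((relevant y).card : ℝ) * (irrelevant y).card := by positivity
    rw [rankingLoss01, ← mul_assoc]
    have h2 : 1 ≤ (c : ℝ) ^ 2 * (1 / (((relevant y).card : ℝ) * (irrelevant y).card)) := by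
      rw [mul_one_div, le_div_iff₀ hpos, one_mul]
      exact hcard
    nlinarith

theorem subsetLoss01_nonneg {c : ℕ} (z y : Labels c) : 0 ≤ subsetLoss01 z y :=
  Real.iSup_nonneg fun j => by split_ifs <;> norm_num

section Kernel

variable {X H : Type*} [MeasurableSpace X] [NormedAddCommGroup H] [InnerProductSpace ℝ H]

/-- Linear functionals of a feature map of a measurable kernel are measurable. -/
theorem measurable_inner_featureMap [CompleteSpace H] {κ : X → X → ℝ}
    (hκ : Measurable fun p : X × X => κ p.1 p.2) {φ : X → H} (hφ : IsFeatureMap κ φ) (w : H) :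
    Measurable fun x => inner ℝ w (φ x) := by
  let M : Submodule ℝ H :=
    { carrier := {w | Measurable fun x => inner ℝ w (φ x)}
      add_mem' := fun {a b} ha hb => by
        simp only [Set.mem_ofPred_eq, inner_add_left] at *
        exact ha.add hb
      zero_mem' := by simp
      smul_mem' := fun r a ha => by
        simp only [Set.mem_ofPred_eq, real_inner_smul_left] at *
        exact ha.const_mul r }
  have hcl : IsClosed (M : Set H) := by
    refine IsSeqClosed.isClosed fun u w hu huw => ?_
    refine measurable_of_tendsto_metrizable (f := fun k x => inner ℝ (u k) (φ x)) hu ?_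
    exact tendsto_pi_nhds.2 fun x => huw.inner tendsto_const_nhds
  have hφM : ∀ x, φ x ∈ M := fun x => by
    change Measurable fun x' => inner ℝ (φ x) (φ x')
    simp only [← hφ x]
    exact hκ.comp measurable_prodMk_left
  have : CompleteSpace M := hcl.completeSpace_coe
  have htop : M = ⊤ := by
    rw [← Submodule.orthogonal_eq_bot_iff, Submodule.eq_bot_iff]
    intro u hu
    have huM : u ∈ M := by
      change Measurable fun x => inner ℝ u (φ x)
      have : ∀ x, inner ℝ u (φ x) = 0 := fun x =>
        Submodule.inner_left_of_mem_orthogonal (hφM x) hu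
      simp [this]
    exact inner_self_eq_zero.1 (Submodule.inner_left_of_mem_orthogonal huM hu)
  have : w ∈ M := htop ▸ Submodule.mem_top
  exact this

end Kernel

section Kernel

variable {X H : Type*} [NormedAddCommGroup H] [InnerProductSpace ℝ H]

/-- The surrogate ranking loss of the kernel hypothesis with parameter `W`. -/
noncomputable def kernelLoss {c : ℕ} (ℓ : ℝ → ℝ) (φ : X → H) (W : PiLp 2 fun _ : Fin c => H)
    (y : X × Labels c) : ℝ :=
  rankingLoss ℓ (fun j => inner ℝ (W j) (φ y.1)) y.2

/-- The vector representing the difference of the scores `p` and `q` at the feature `u`. -/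
def pairVector {c : ℕ} (p q : Fin c) (u : H) : PiLp 2 fun _ : Fin c => H :=
  WithLp.toLp 2 fun j => (if j = p then u else 0) - if j = q then u else 0

theorem inner_pairVector {c : ℕ} (W : PiLp 2 fun _ : Fin c => H) (p q : Fin c) (u : H) :
    inner ℝ W (pairVector p q u) = inner ℝ (W p) u - inner ℝ (W q) u := by
  have h : ∀ j p : Fin c, inner ℝ (W j) (if j = p then u else 0) =
      if j = p then inner ℝ (W j) u else 0 := by
    intro j p; split_ifs <;> simp
  simp [PiLp.inner_apply, pairVector, inner_sub_right, h, Finset.sum_sub_distrib]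

theorem norm_pairVector_sq_le {c : ℕ} (p q : Fin c) (u : H) :
    ‖pairVector p q u‖ ^ 2 ≤ 2 * ‖u‖ ^ 2 := by
  rw [← real_inner_self_eq_norm_sq, inner_pairVector]
  by_cases h : p = q
  · subst h
    rw [sub_self]
    positivity
  · simp [pairVector, h, Ne.symm h]
    linarith

/-- The symmetrized Rademacher averages of the kernel class with the ranking loss. -/
theorem signAvg_ciSup_kernelLoss_le {c n : ℕ} (hc : 0 < c) {ℓ : ℝ → ℝ} {ρ : NNReal}
    (hℓ : LipschitzWith ρ ℓ) (φ : X → H) {Λ r B : ℝ} (hΛ : 0 ≤ Λ) (hr : 0 ≤ r)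
    (hφr : ∀ x, ‖φ x‖ ≤ r)
    (hB : ∀ (w : Metric.closedBall (0 : PiLp 2 fun _ : Fin c => H) Λ) y,
      |kernelLoss ℓ φ (w : PiLp 2 fun _ : Fin c => H) y| ≤ B)
    (p : (Fin n → X × Labels c) × (Fin n → X × Labels c)) :
    signAvg (fun ε => ⨆ w : Metric.closedBall (0 : PiLp 2 fun _ : Fin c => H) Λ,
      ∑ i, signReal (ε i) * (kernelLoss ℓ φ w (p.2 i) - kernelLoss ℓ φ w (p.1 i))) ≤
      2 * √2 * ρ * Λ * r * √n := by
  choose m hm0 hm1 hm using exists_weights_abs_rankingLoss_sub_le hc hℓ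
  let pt : Bool → Fin n → X × Labels c := fun b i => if b then p.2 i else p.1 i
  let M : Fin n → Bool × (Fin c × Fin c) → ℝ := fun i k => m (pt k.1 i).2 k.2 / 2
  let ψ : Fin n → Bool × (Fin c × Fin c) → PiLp 2 fun _ : Fin c => H := fun i k =>
    (2 * (ρ : ℝ)) • pairVector k.2.1 k.2.2 (φ (pt k.1 i).1)
  have hM1 : ∀ i, ∑ k, M i k = 1 := by
    intro i
    simp only [M, Fintype.sum_prod_type (f := fun k : Bool × (Fin c × Fin c) => _),
      Fintype.sum_bool, ← Finset.sum_div]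
    rw [hm1, hm1]
    norm_num
  have hψ : ∀ i k (w w' : PiLp 2 fun _ : Fin c => H),
      M i k * |inner ℝ w (ψ i k) - inner ℝ w' (ψ i k)| =
      m (pt k.1 i).2 k.2 * (ρ *
        |(inner ℝ (w k.2.1) (φ (pt k.1 i).1) - inner ℝ (w k.2.2) (φ (pt k.1 i).1)) -
          (inner ℝ (w' k.2.1) (φ (pt k.1 i).1) - inner ℝ (w' k.2.2) (φ (pt k.1 i).1))|) := by
    intro i k w w'
    simp only [M, ψ, real_inner_smul_right, inner_pairVector, ← mul_sub]
    rw [abs_mul, abs_of_nonneg (by positivity : 0 ≤ 2 * (ρ : ℝ))]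
    ring
  have h := signAvg_ciSup_closedBall_le Λ hΛ
    (fun i (w : PiLp 2 fun _ : Fin c => H) =>
      kernelLoss ℓ φ w (p.2 i) - kernelLoss ℓ φ w (p.1 i)) M ψ
    (fun i k => div_nonneg (hm0 _ _) (by norm_num)) hM1
    (fun i w w' => ?_)
    (fun i => ⟨B + B, fun w => (abs_sub _ _).trans (add_le_add (hB w _) (hB w _))⟩) 0
  · simp only [inner_zero_right, zero_add] at h
    refine h.trans ?_
    have hs : ∀ i, ∑ k, M i k * ‖ψ i k‖ ^ 2 ≤ 8 * ρ ^ 2 * r ^ 2 := by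
      intro i
      calc ∑ k, M i k * ‖ψ i k‖ ^ 2 ≤ ∑ k, M i k * (8 * ρ ^ 2 * r ^ 2) := by
            refine Finset.sum_le_sum fun k _ => mul_le_mul_of_nonneg_left ?_
              (div_nonneg (hm0 _ _) (by norm_num))
            have h1 := norm_pairVector_sq_le k.2.1 k.2.2 (φ (pt k.1 i).1)
            have h2 : ‖φ (pt k.1 i).1‖ ^ 2 ≤ r ^ 2 :=
              pow_le_pow_left₀ (norm_nonneg _) (hφr _) 2
            simp only [ψ]
            rw [norm_smul, mul_pow, Real.norm_eq_abs, sq_abs]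
            calc (2 * (ρ : ℝ)) ^ 2 * ‖pairVector k.2.1 k.2.2 (φ (pt k.1 i).1)‖ ^ 2 ≤
                  (2 * (ρ : ℝ)) ^ 2 * (2 * r ^ 2) := by gcongr; linarith
              _ = 8 * ρ ^ 2 * r ^ 2 := by ring
        _ = 8 * ρ ^ 2 * r ^ 2 := by rw [← Finset.sum_mul, hM1, one_mul]
    have hle : ‖(0 : PiLp 2 fun _ : Fin c => H)‖ ^ 2 + ∑ i, ∑ k, M i k * ‖ψ i k‖ ^ 2 ≤
        (2 * √2 * ρ * r * √n) ^ 2 := by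
      have h3 := Finset.sum_le_sum fun i (_ : i ∈ Finset.univ) => hs i
      simp only [Finset.sum_const, Finset.card_univ, Fintype.card_fin, nsmul_eq_mul] at h3
      simp only [mul_pow, Real.sq_sqrt (Nat.cast_nonneg n), Real.sq_sqrt zero_le_two, norm_zero]
      linarith
    calc _ ≤ Λ * (2 * √2 * ρ * r * √n) := by
          gcongr
          exact Real.sqrt_le_iff.2 ⟨by positivity, hle⟩
      _ = _ := by ring
  · simp only [hψ]
    rw [Fintype.sum_prod_type, Fintype.sum_bool]
    have e : ∀ b, |kernelLoss ℓ φ w (pt b i) - kernelLoss ℓ φ w' (pt b i)| ≤ _ := fun b =>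
      hm (pt b i).2 (fun j => inner ℝ (w j) (φ (pt b i).1))
        (fun j => inner ℝ (w' j) (φ (pt b i).1))
    have e1 := e true
    have e2 := e false
    calc |kernelLoss ℓ φ w (p.2 i) - kernelLoss ℓ φ w (p.1 i) -
            (kernelLoss ℓ φ w' (p.2 i) - kernelLoss ℓ φ w' (p.1 i))|
        = |(kernelLoss ℓ φ w (pt true i) - kernelLoss ℓ φ w' (pt true i)) -
            (kernelLoss ℓ φ w (pt false i) - kernelLoss ℓ φ w' (pt false i))| := by
          congr 1
          simp only [pt, if_true, Bool.false_eq_true, if_false]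
          ring
      _ ≤ _ := (abs_sub _ _).trans (add_le_add e1 e2)

theorem continuous_kernelLoss {c : ℕ} {ℓ : ℝ → ℝ} (hℓ : Continuous ℓ) (φ : X → H)
    (y : X × Labels c) :
    Continuous fun W : PiLp 2 fun _ : Fin c => H => kernelLoss ℓ φ W y := by
  simp only [kernelLoss, rankingLoss]
  fun_prop

theorem measurable_kernelLoss [MeasurableSpace X] [CompleteSpace H] {c : ℕ} {ℓ : ℝ → ℝ}
    (hℓ : Measurable ℓ) {κ : X → X → ℝ} (hκ : Measurable fun p : X × X => κ p.1 p.2) {φ : X → H}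
    (hφ : IsFeatureMap κ φ) (W : PiLp 2 fun _ : Fin c => H) :
    Measurable fun y : X × Labels c => kernelLoss ℓ φ W y := by
  unfold kernelLoss
  exact hℓ.rankingLoss (fun j => (measurable_inner_featureMap hκ hφ (W j)).comp measurable_fst)
    measurable_snd

/-- The parameter whose components are the linear combinations of the vectors `u k` with
coefficients `α j`. -/
def combination {c : ℕ} {K : Type*} [Fintype K] (u : K → H) (α : Fin c → K → ℝ) :
    PiLp 2 fun _ : Fin c => H :=
  WithLp.toLp 2 fun j => ∑ k, α j k • u k

/-- The linear combination, shrunk into the ball of radius `Λ`. -/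
noncomputable def shrunkCombination {c : ℕ} {K : Type*} [Fintype K] (Λ : ℝ) (u : K → H)
    (α : Fin c → K → ℝ) : PiLp 2 fun _ : Fin c => H :=
  (Λ / max Λ ‖combination u α‖) • combination u α

theorem continuous_combination {c : ℕ} {K : Type*} [Fintype K] (u : K → H) :
    Continuous fun α : Fin c → K → ℝ => combination u α := by
  unfold combination
  fun_prop

theorem continuous_shrunkCombination {c : ℕ} {K : Type*} [Fintype K] {Λ : ℝ} (hΛ : 0 ≤ Λ)
    (u : K → H) : Continuous fun α : Fin c → K → ℝ => shrunkCombination Λ u α := by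
  unfold shrunkCombination
  rcases hΛ.eq_or_lt with h | h
  · simpa [← h] using continuous_const
  · refine Continuous.smul (continuous_const.div (continuous_const.max
      (continuous_combination u).norm) fun α => ?_) (continuous_combination u)
    exact (lt_max_of_lt_left h).ne'

theorem shrunkCombination_mem_closedBall {c : ℕ} {K : Type*} [Fintype K] {Λ : ℝ} (hΛ : 0 ≤ Λ)
    (u : K → H) (α : Fin c → K → ℝ) :
    shrunkCombination Λ u α ∈ Metric.closedBall (0 : PiLp 2 fun _ : Fin c => H) Λ := by
  rw [mem_closedBall_zero_iff, shrunkCombination, norm_smul, Real.norm_eq_abs,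
    abs_of_nonneg (by positivity), div_mul_eq_mul_div]
  refine div_le_of_le_mul₀ (by positivity) hΛ ?_
  gcongr
  exact le_max_right _ _

/-- Representer property: inside the ball, every parameter acts on finitely many vectors like a
linear combination of these vectors. -/
theorem exists_shrunkCombination {c : ℕ} {K : Type*} [Fintype K] {Λ : ℝ} (u : K → H)
    {W : PiLp 2 fun _ : Fin c => H}
    (hW : W ∈ Metric.closedBall (0 : PiLp 2 fun _ : Fin c => H) Λ) :
    ∃ α : Fin c → K → ℝ, ∀ j k, inner ℝ (shrunkCombination Λ u α j) (u k) = inner ℝ (W j) (u k) := by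
  let V : Submodule ℝ H := Submodule.span ℝ (Set.range u)
  have : FiniteDimensional ℝ V := FiniteDimensional.span_of_finite ℝ (Set.finite_range u)
  have hV : ∀ j, ∃ a : K → ℝ, ∑ k, a k • u k = V.starProjection (W j) := fun j =>
    (Submodule.mem_span_range_iff_exists_fun ℝ).1 (V.starProjection_apply_mem (W j))
  choose α hα using hV
  have hnorm : ‖combination u α‖ ≤ ‖W‖ := by
    refine le_of_sq_le_sq ?_ (norm_nonneg _)
    rw [PiLp.norm_sq_eq_of_L2, PiLp.norm_sq_eq_of_L2]
    gcongr with j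
    simp only [combination, hα]
    exact V.norm_starProjection_apply_le (W j)
  have hle : ‖combination u α‖ ≤ Λ := hnorm.trans (mem_closedBall_zero_iff.1 hW)
  have hs : shrunkCombination Λ u α = combination u α := by
    rw [shrunkCombination, max_eq_left hle]
    rcases eq_or_ne Λ 0 with h | h
    · have : combination u α = 0 := norm_le_zero_iff.1 (h ▸ hle)
      rw [this, smul_zero]
    · rw [div_self h, one_smul]
  refine ⟨α, fun j k => ?_⟩
  rw [hs]
  simp only [combination, hα]
  have hk : u k ∈ V := Submodule.subset_span ⟨k, rfl⟩
  have h1 := V.inner_starProjection_left_eq_right (W j) (u k)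
  rw [h1, V.starProjection_eq_self_iff.2 hk]

theorem measurable_norm_combination [MeasurableSpace X] {Ω : Type*} [MeasurableSpace Ω] {c : ℕ}
    {K : Type*} [Fintype K] {κ : X → X → ℝ} (hκ : Measurable fun p : X × X => κ p.1 p.2)
    {φ : X → H} (hφ : IsFeatureMap κ φ) (x : K → Ω → X) (hx : ∀ k, Measurable (x k))
    (α : Fin c → K → ℝ) :
    Measurable fun ω => ‖combination (fun k => φ (x k ω)) α‖ := by
  have h : ∀ ω, ‖combination (fun k => φ (x k ω)) α‖ =
      √(∑ j, ∑ k, ∑ k', α j k * (α j k' * κ (x k ω) (x k' ω))) := by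
    intro ω
    rw [PiLp.norm_eq_of_L2]
    congr 1
    refine Finset.sum_congr rfl fun j _ => ?_
    rw [← real_inner_self_eq_norm_sq]
    simp only [combination, sum_inner, inner_sum, real_inner_smul_left, real_inner_smul_right,
      hφ _ _]
    rw [Finset.sum_comm]
    exact Finset.sum_congr rfl fun k _ => Finset.sum_congr rfl fun k' _ => by ring
  simp only [h]
  have hk : ∀ k k', Measurable fun ω => κ (x k ω) (x k' ω) := fun k k' =>
    hκ.comp ((hx k).prodMk (hx k'))
  fun_prop

/-- The supremum of the differences of the empirical losses on two samples over the ball is a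
measurable function of the two samples. -/
theorem measurable_ciSup_kernelLoss_sub [MeasurableSpace X] {c n : ℕ} {ℓ : ℝ → ℝ}
    (hℓ : Continuous ℓ) {κ : X → X → ℝ} (hκ : Measurable fun p : X × X => κ p.1 p.2) {φ : X → H}
    (hφ : IsFeatureMap κ φ) {Λ B : ℝ} (hΛ : 0 ≤ Λ)
    (hB : ∀ (w : Metric.closedBall (0 : PiLp 2 fun _ : Fin c => H) Λ) y,
      |kernelLoss ℓ φ (w : PiLp 2 fun _ : Fin c => H) y| ≤ B) :
    Measurable fun p : (Fin n → X × Labels c) × (Fin n → X × Labels c) =>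
      ⨆ w : Metric.closedBall (0 : PiLp 2 fun _ : Fin c => H) Λ,
        ∑ i, (kernelLoss ℓ φ w (p.2 i) - kernelLoss ℓ φ w (p.1 i)) := by
  let x : Bool × Fin n → (Fin n → X × Labels c) × (Fin n → X × Labels c) → X := fun k p =>
    if k.1 then (p.2 k.2).1 else (p.1 k.2).1
  have hx : ∀ k, Measurable (x k) := by
    rintro ⟨b, i⟩
    cases b
    · simp only [x, Bool.false_eq_true, if_false]; fun_prop
    · simp only [x, if_true]; fun_prop
  let F : (Fin n → X × Labels c) × (Fin n → X × Labels c) → (PiLp 2 fun _ : Fin c => H) → ℝ :=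
    fun p w => ∑ i, (kernelLoss ℓ φ w (p.2 i) - kernelLoss ℓ φ w (p.1 i))
  have hFc : ∀ p, Continuous (F p) := fun p => continuous_finsetSum _ fun i _ =>
    (continuous_kernelLoss hℓ φ _).sub (continuous_kernelLoss hℓ φ _)
  have hFb : ∀ p (w : Metric.closedBall (0 : PiLp 2 fun _ : Fin c => H) Λ),
      |F p w| ≤ ∑ _ : Fin n, (B + B) := fun p w =>
    (Finset.abs_sum_le_sum_abs _ _).trans
      (Finset.sum_le_sum fun i _ => (abs_sub _ _).trans (add_le_add (hB w _) (hB w _)))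
  let cast : (Fin c → Bool × Fin n → ℚ) → Fin c → Bool × Fin n → ℝ := fun α j k => α j k
  have hdense : DenseRange cast :=
    DenseRange.piMap fun _ => DenseRange.piMap fun _ => Rat.denseRange_cast
  let G : (Fin n → X × Labels c) × (Fin n → X × Labels c) → (Fin c → Bool × Fin n → ℝ) → ℝ :=
    fun p α => F p (shrunkCombination Λ (fun k => φ (x k p)) α)
  have hGb : ∀ p, BddAbove (Set.range fun α => G p (cast α)) := fun p =>
    bddAbove_range_of_abs_le fun α => hFb p ⟨_, shrunkCombination_mem_closedBall hΛ _ _⟩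
  have hGF : ∀ p, (⨆ w : Metric.closedBall (0 : PiLp 2 fun _ : Fin c => H) Λ, F p w) =
      ⨆ α, G p (cast α) := by
    intro p
    have : Nonempty (Metric.closedBall (0 : PiLp 2 fun _ : Fin c => H) Λ) :=
      ⟨⟨0, Metric.mem_closedBall_self hΛ⟩⟩
    refine le_antisymm (ciSup_le fun w => ?_) (ciSup_le fun α => ?_)
    · obtain ⟨α, hα⟩ := exists_shrunkCombination (fun k => φ (x k p)) w.2
      have hw : F p w = G p α := by
        refine Finset.sum_congr rfl fun i _ => ?_
        have h1 := fun j => hα j (true, i)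
        have h2 := fun j => hα j (false, i)
        simp only [x, if_true, Bool.false_eq_true, if_false] at h1 h2
        simp only [kernelLoss, x, h1, h2]
      rw [hw]
      have hclosed : IsClosed {α | G p α ≤ ⨆ α, G p (cast α)} :=
        isClosed_le ((hFc p).comp (continuous_shrunkCombination hΛ _)) continuous_const
      exact hdense.induction_on (p := fun α => G p α ≤ ⨆ α, G p (cast α)) α hclosed
        fun β => le_ciSup (hGb p) β
    · exact le_ciSup (bddAbove_range_of_abs_le (hFb p))
        (⟨_, shrunkCombination_mem_closedBall hΛ _ _⟩ :
          Metric.closedBall (0 : PiLp 2 fun _ : Fin c => H) Λ)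
  change Measurable fun p => ⨆ w : Metric.closedBall (0 : PiLp 2 fun _ : Fin c => H) Λ, F p w
  simp only [hGF]
  refine Measurable.iSup fun α => ?_
  have hnorm := measurable_norm_combination hκ hφ x hx (cast α)
  have hscore : ∀ y : (Fin n → X × Labels c) × (Fin n → X × Labels c) → X × Labels c,
      Measurable y → Measurable fun p =>
        kernelLoss ℓ φ (shrunkCombination Λ (fun k => φ (x k p)) (cast α)) (y p) := by
    intro y hy
    have hs : ∀ p j, inner ℝ (shrunkCombination Λ (fun k => φ (x k p)) (cast α) j) (φ (y p).1) =
        Λ / max Λ ‖combination (fun k => φ (x k p)) (cast α)‖ *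
          ∑ k, cast α j k * κ (x k p) (y p).1 := by
      intro p j
      rw [shrunkCombination, PiLp.smul_apply, real_inner_smul_left]
      simp only [combination, sum_inner, real_inner_smul_left, hφ _ _]
    simp only [kernelLoss, hs]
    refine hℓ.measurable.rankingLoss (fun j => ?_) hy.snd
    have hk : ∀ k, Measurable fun p => κ (x k p) (y p).1 := fun k =>
      hκ.comp ((hx k).prodMk hy.fst)
    fun_prop
  refine Finset.measurable_sum _ fun i _ => (hscore _ ?_).sub (hscore _ ?_)
  · fun_prop
  · fun_prop

end Kernel

theorem exists_mem_closedBall_of_mem_kernelClass {X H : Type*} [NormedAddCommGroup H]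
    [InnerProductSpace ℝ H] {c : ℕ} {φ : X → H} {Λ : ℝ} {f : X → Fin c → ℝ}
    (hf : f ∈ kernelClass c φ Λ) :
    ∃ W ∈ Metric.closedBall (0 : PiLp 2 fun _ : Fin c => H) Λ,
      f = fun x j => inner ℝ (W j) (φ x) := by
  obtain ⟨W, hW, rfl⟩ := hf
  refine ⟨WithLp.toLp 2 W, ?_, rfl⟩
  rw [mem_closedBall_zero_iff, PiLp.norm_eq_of_L2]
  exact hW

theorem mem_kernelClass_of_mem_closedBall {X H : Type*} [NormedAddCommGroup H]
    [InnerProductSpace ℝ H] {c : ℕ} (φ : X → H) {Λ : ℝ} {W : PiLp 2 fun _ : Fin c => H}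
    (hW : W ∈ Metric.closedBall (0 : PiLp 2 fun _ : Fin c => H) Λ) :
    (fun x j => inner ℝ (W j) (φ x)) ∈ kernelClass c φ Λ := by
  refine ⟨W, ?_, rfl⟩
  rwa [mem_closedBall_zero_iff, PiLp.norm_eq_of_L2] at hW

/-- The subset risk of an oracle thresholding is bounded by the ranking risk. -/
theorem subsetRisk01_le_sq_mul_rankingRisk01 {X : Type*} [MeasurableSpace X] {c : ℕ} (hc : 0 < c)
    (D : Measure (X × Labels c)) [IsProbabilityMeasure D]
    {t : (Fin c → ℝ) → Labels c → Labels c} (ht : IsOracleThresholding t) {f : X → Fin c → ℝ}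
    (hf : ∀ j, Measurable fun x => f x j) :
    subsetRisk01 D t f ≤ (c : ℝ) ^ 2 * rankingRisk01 D f := by
  have hm : Measurable fun z : X × Labels c => rankingLoss01 (f z.1) z.2 := by
    simp only [rankingLoss01_eq_rankingLoss]
    exact Measurable.rankingLoss
      (Measurable.ite measurableSet_Iic measurable_const measurable_const)
      (fun j => (hf j).comp measurable_fst) measurable_snd
  have hi : Integrable (fun z : X × Labels c => rankingLoss01 (f z.1) z.2) D := by
    refine Integrable.of_bound (C := 1) hm.aestronglyMeasurable
      (Filter.Eventually.of_forall fun z => ?_)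
    rw [rankingLoss01_eq_rankingLoss, Real.norm_eq_abs, abs_of_nonneg
      (rankingLoss_nonneg (fun u => by split_ifs <;> norm_num) _ _)]
    exact rankingLoss_le zero_le_one (fun p q => by split_ifs <;> norm_num) _
  rw [subsetRisk01, rankingRisk01, ← integral_const_mul]
  exact integral_mono_of_nonneg (Filter.Eventually.of_forall fun z => subsetLoss01_nonneg _ _)
    (hi.const_mul _)
    (Filter.Eventually.of_forall fun z => subsetLoss01_le_sq_mul_rankingLoss01 hc ht _ _)

theorem mainTheorem10
    {X : Type*} [MeasurableSpace X]
    {H : Type*} [NormedAddCommGroup H] [InnerProductSpace ℝ H] [CompleteSpace H]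
    (c n : ℕ) (hc : 0 < c) (hn : 0 < n)
    (D : Measure (X × Labels c)) [IsProbabilityMeasure D]
    (κ : X → X → ℝ) (hκ : Measurable fun p : X × X => κ p.1 p.2)
    (φ : X → H) (hφ : IsFeatureMap κ φ)
    (Λ r B : ℝ) (hr : 0 < r) (hκr : ∀ x, κ x x ≤ r ^ 2)
    (ℓ : ℝ → ℝ) (ρ : NNReal) (hℓLip : LipschitzWith ρ ℓ) (hℓ01 : BoundsZeroOne ℓ)
    -- the base loss is bounded by `B` at all the score differences that occur
    (hℓB : ∀ f ∈ kernelClass c φ Λ, ∀ x p q, ℓ (f x p - f x q) ≤ B)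
    (tstar : (Fin c → ℝ) → Labels c → Labels c) (htstar : IsOracleThresholding tstar)
    (δ : ℝ) (hδ : 0 < δ) :
    -- the law of the i.i.d. sample `S` of size `n` is the product measure
    ∃ A : Set (Fin n → X × Labels c), MeasurableSet A ∧
      ENNReal.ofReal (1 - δ) ≤ (Measure.pi fun _ : Fin n => D) A ∧
      ∀ S ∈ A, ∀ f ∈ kernelClass c φ Λ,
        subsetRisk01 D tstar f ≤ (c : ℝ) ^ 2 * rankingRisk01 D f ∧
        (c : ℝ) ^ 2 * rankingRisk01 D f ≤
          (c : ℝ) ^ 2 * empRankingRisk ℓ S f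
            + 2 * Real.sqrt 2 * (ρ : ℝ) * Real.sqrt ((c : ℝ) ^ 5 * Λ ^ 2 * r ^ 2 / (n : ℝ))
            + 3 * B * (c : ℝ) ^ 2 * Real.sqrt (Real.log (2 / δ) / (2 * (n : ℝ))) := by
  rcases lt_or_ge Λ 0 with hΛ | hΛ
  · refine ⟨Set.univ, MeasurableSet.univ, ?_, ?_⟩
    · rw [measure_univ]
      exact ENNReal.ofReal_le_one.2 (by linarith)
    · rintro S - f ⟨W, hW, -⟩
      exact absurd ((Real.sqrt_nonneg _).trans hW) (not_le.2 hΛ)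
  rcases lt_or_ge 1 δ with hδ1 | hδ1
  · refine ⟨∅, MeasurableSet.empty, ?_, fun S hS => absurd hS (Set.notMem_empty S)⟩
    rw [ENNReal.ofReal_of_nonpos (by linarith)]
    exact zero_le
  have hℓ0 : ∀ u, 0 ≤ ℓ u := fun u => le_trans (by split_ifs <;> norm_num) (hℓ01 u)
  have hB : 0 < B := by
    obtain ⟨⟨x, -⟩⟩ := nonempty_of_isProbabilityMeasure D
    have h := hℓB _ (mem_kernelClass_of_mem_closedBall φ
      (Metric.mem_closedBall_self hΛ : (0 : PiLp 2 fun _ : Fin c => H) ∈ _)) x ⟨0, hc⟩ ⟨0, hc⟩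
    have h1 := hℓ01 0
    simp only [le_refl, if_true] at h1
    simp only [sub_self] at h
    linarith
  have hφr : ∀ x, ‖φ x‖ ≤ r := fun x => by
    refine le_of_sq_le_sq ?_ hr.le
    rw [← real_inner_self_eq_norm_sq, ← hφ x x]
    exact hκr x
  have h0 : ∀ (w : Metric.closedBall (0 : PiLp 2 fun _ : Fin c => H) Λ) y,
      0 ≤ kernelLoss ℓ φ (w : PiLp 2 fun _ : Fin c => H) y := fun w y => rankingLoss_nonneg hℓ0 _ _
  have h1 : ∀ (w : Metric.closedBall (0 : PiLp 2 fun _ : Fin c => H) Λ) y,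
      kernelLoss ℓ φ (w : PiLp 2 fun _ : Fin c => H) y ≤ B := fun w y =>
    rankingLoss_le hB.le (hℓB _ (mem_kernelClass_of_mem_closedBall φ w.2) y.1) _
  have hbd : ∀ (w : Metric.closedBall (0 : PiLp 2 fun _ : Fin c => H) Λ) y,
      |kernelLoss ℓ φ (w : PiLp 2 fun _ : Fin c => H) y| ≤ B := fun w y => by
    rw [abs_of_nonneg (h0 w y)]
    exact h1 w y
  have hm : ∀ w : Metric.closedBall (0 : PiLp 2 fun _ : Fin c => H) Λ,
      Measurable fun y : X × Labels c => kernelLoss ℓ φ (w : PiLp 2 fun _ : Fin c => H) y :=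
    fun w => measurable_kernelLoss hℓLip.continuous.measurable hκ hφ
      (w : PiLp 2 fun _ : Fin c => H)
  have : Nonempty (Metric.closedBall (0 : PiLp 2 fun _ : Fin c => H) Λ) :=
    ⟨⟨0, Metric.mem_closedBall_self hΛ⟩⟩
  have hsup := measurable_ciSup_kernelLoss_sub (n := n) hℓLip.continuous hκ hφ hΛ hbd
  have hR := signAvg_ciSup_kernelLoss_le (n := n) hc hℓLip φ hΛ hr.le hφr hbd
  obtain ⟨A, hA, hAδ, hAle⟩ := exists_measurableSet_uniform_deviation D hn
    (fun (w : Metric.closedBall (0 : PiLp 2 fun _ : Fin c => H) Λ) (y : X × Labels c) =>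
      kernelLoss ℓ φ (w : PiLp 2 fun _ : Fin c => H) y)
    hm B (2 * √2 * ρ * Λ * r * √n) hB h0 h1 hsup hR δ hδ hδ1
  refine ⟨A, hA, hAδ, fun S hS f hf => ?_⟩
  obtain ⟨W, hW, rfl⟩ := exists_mem_closedBall_of_mem_kernelClass hf
  have hfm : ∀ j, Measurable fun x => inner ℝ (W j) (φ x) := fun j =>
    measurable_inner_featureMap hκ hφ (W j)
  refine ⟨subsetRisk01_le_sq_mul_rankingRisk01 hc D htstar hfm, ?_⟩
  have hn' : (0 : ℝ) < n := by exact_mod_cast hn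
  have hc1 : (1 : ℝ) ≤ c := by exact_mod_cast hc
  have hrisk : rankingRisk01 D (fun x j => inner ℝ (W j) (φ x)) ≤ ∫ y, kernelLoss ℓ φ W y ∂D := by
    have hi : Integrable (fun y => kernelLoss ℓ φ W y) D :=
      Integrable.of_bound (C := B) (hm ⟨W, hW⟩).aestronglyMeasurable
        (Filter.Eventually.of_forall fun z => hbd ⟨W, hW⟩ z)
    rw [rankingRisk01]
    refine integral_mono_of_nonneg (Filter.Eventually.of_forall fun z => ?_) hi
      (Filter.Eventually.of_forall fun z => rankingLoss01_le_rankingLoss hℓ01 _ _)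
    simp only [rankingLoss01_eq_rankingLoss]
    exact rankingLoss_nonneg (fun u => by split_ifs <;> norm_num) _ _
  have hdev := hAle S hS ⟨W, hW⟩
  have hemp : ∑ i, kernelLoss ℓ φ W (S i) =
      n * empRankingRisk ℓ S (fun x j => inner ℝ (W j) (φ x)) := by
    simp only [empRankingRisk, kernelLoss]
    field_simp
  simp only [hemp] at hdev
  set E := empRankingRisk ℓ S (fun x j => inner ℝ (W j) (φ x))
  set q := √(Real.log (2 / δ) / (2 * (n : ℝ)))
  have hsqrt : Λ * r * √n ≤ n * √((c : ℝ) * Λ ^ 2 * r ^ 2 / n) := by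
    have h2 : Λ * r / √n ≤ √((c : ℝ) * Λ ^ 2 * r ^ 2 / n) := by
      refine Real.le_sqrt_of_sq_le ?_
      rw [div_pow, Real.sq_sqrt hn'.le, mul_pow]
      gcongr
      nlinarith [sq_nonneg (Λ * r)]
    calc Λ * r * √n = n * (Λ * r / √n) := by
          have h3 := Real.mul_self_sqrt hn'.le
          have h4 : √(n : ℝ) ≠ 0 := (Real.sqrt_pos.2 hn').ne'
          field_simp
          rw [sq, h3]
      _ ≤ _ := by gcongr
  have hdev' : ∫ y, kernelLoss ℓ φ W y ∂D ≤
      E + 2 * √2 * ρ * √((c : ℝ) * Λ ^ 2 * r ^ 2 / n) + 3 * B * q := by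
    refine le_of_mul_le_mul_left ?_ hn'
    have h3 : 2 * √2 * ρ * Λ * r * √n ≤
        2 * √2 * ρ * (n * √((c : ℝ) * Λ ^ 2 * r ^ 2 / n)) := by
      calc 2 * √2 * ρ * Λ * r * √n = 2 * √2 * ρ * (Λ * r * √n) := by ring
        _ ≤ _ := by gcongr
    linarith
  have h5 : √((c : ℝ) ^ 5 * Λ ^ 2 * r ^ 2 / n) =
      (c : ℝ) ^ 2 * √((c : ℝ) * Λ ^ 2 * r ^ 2 / n) := by
    rw [← Real.sqrt_sq (by positivity : (0 : ℝ) ≤ (c : ℝ) ^ 2), ← Real.sqrt_mul (by positivity)]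
    congr 1
    ring
  rw [h5]
  calc (c : ℝ) ^ 2 * rankingRisk01 D (fun x j => inner ℝ (W j) (φ x)) ≤
        (c : ℝ) ^ 2 * (E + 2 * √2 * ρ * √((c : ℝ) * Λ ^ 2 * r ^ 2 / n) + 3 * B * q) := by
        gcongr
        exact hrisk.trans hdev'
    _ = _ := by ring
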